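/- Conventions. Let $\mathsf V$ be a pseudovariety of semigroups, that is, a class of finite semigroups closed under subsemigroups, homomorphic images and finite direct products. A language $L\subseteq A^+$ over a finite alphabet $A$ is $\mathsf V$-recognizable if $L=\varphi^{-1}\varphi(L)$ for some homomorphism $\varphi$ from $A^+$ into a semigroup of $\mathsf V$. We say that $\mathsf V$ is closed under bideterministic product if, for every finite alphabet $A$, every letter $a\in A$ and all $L,K\subseteq A^*$, each of which is either a $\mathsf V$-recognizable language of $A^+$ or equal to $\{1\}$, such that $La$ is a prefix code (no element of $La$ is a proper prefix of another one) and $aK$ is a suffix code (dually), the language $LaK$ is a $\mathsf V$-recognizable language of $A^+$. For a finite alphabet $A$, let $\overline{\Omega}_A\mathsf V$ be the free pro-$\mathsf V$ semigroup on $A$, let $\overline{\Omega}_A\mathsf S$ be the free profinite semigroup on $A$, whose elements are called pseudowords and which contains $A^+$, and let $\pi\mapsto[\pi]_{\mathsf V}$ be the natural projection $\overline{\Omega}_A\mathsf S\to\overline{\Omega}_A\mathsf V$. We write $\mathsf V\models\pi=\rho$ if $\hat\varphi(\pi)=\hat\varphi(\rho)$ for every $S\in\mathsf V$ and every map $\varphi\colon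 A\to S$, where $\hat\varphi\colon\overline{\Omega}_A\mathsf S\to S$ is its continuous homomorphic extension. A pseudoword $\pi$ is $\mathsf V$-multiregular if $[\pi]_{\mathsf V}$ is a non-empty finite product of regular elements of $\overline{\Omega}_A\mathsf V$ (an element $s$ of a semigroup $T$ is regular if $s\in sTs$). We write $s<_{\mathcal R}t$ if $s\in tT^I$ and $t\notin sT^I$, and $s<_{\mathcal L}t$ if $s\in T^It$ and $t\notin T^Is$, where $T^I$ is $T$ with a new identity adjoined. A factorization of $\pi\in\overline{\Omega}_A\mathsf S$ means here an expression $$\pi=u_0\cdot\pi_1\cdot u_1\cdot\pi_2\cdots\pi_n\cdot u_n$$ with $n\ge 0$, $u_0,u_n\in A^*$, $u_i\in A^+$ for $1\le i\le n-1$, and $\pi_i\in\overline{\Omega}_A\mathsf S\setminus A^+$ for $1\le i\le n$. It is multiregularly organized in $\mathsf V$ if every $\pi_i$ is $\mathsf V$-multiregular. It has short $\mathsf V$-breaks if, for all $i\in\{1,\dots,n\}$: when $u_i\ne 1$ has first letter $b$, then $[\pi_i b]_{\mathsf V}<_{\mathcal R}[\pi_i]_{\mathsf V}$; and when $u_{i-1}\ne1$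 has last letter $a$, then $[a\pi_i]_{\mathsf V}<_{\mathcal L}[\pi_i]_{\mathsf V}$. Theorem. Let $\mathsf V$ be a pseudovariety of semigroups closed under bideterministic product, let $A$ be a finite alphabet, and let $\pi,\rho\in\overline{\Omega}_A\mathsf S$ be such that $\mathsf V\models\pi=\rho$. If $$\pi=u_0\cdot\pi_1\cdot u_1\cdots\pi_n\cdot u_n,\qquad \rho=v_0\cdot\rho_1\cdot v_1\cdots\rho_m\cdot v_m$$ are factorizations that are multiregularly organized in $\mathsf V$ and have short $\mathsf V$-breaks, then $n=m$, $u_i=v_i$ for every $i\in\{0,\dots,n\}$, and $\mathsf V\models\pi_j=\rho_j$ for every $j\in\{1,\dots,n\}$. -/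

import Mathlib

universe u

namespace Profinite

/-- A pseudovariety of semigroups: a class of finite semigroups closed under subsemigroups,
homomorphic images and finite direct products. Subsemigroups are taken up to isomorphism, as
domains of injective homomorphisms. (The empty semigroup is allowed as a member; it receives no
map from a non-empty semigroup, and so it has no influence on the notions below.) -/
structure Pseudovariety where
  Mem : (S : Type u) → [Semigroup S] → Prop
  finite_of_mem : ∀ (S : Type u) [Semigroup S], Mem S → Finite S
  sub_mem : ∀ (S T : Type u) [Semigroup S] [Semigroup T] (f : S →ₙ* T),
    Function.Injective f → Mem T → Mem S
  image_mem : ∀ (S T : Type u) [Semigroup S] [Semigroup T] (f : S →ₙ* T),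
    Function.Surjective f → Mem S → Mem T
  pi_mem : ∀ (n : ℕ) (S : Fin n → Type u) [∀ i, Semigroup (S i)],
    (∀ i, Mem (S i)) → Mem (∀ i, S i)

/-- The pseudovariety of all finite semigroups. -/
def allFinite : Pseudovariety.{u} where
  Mem S _ := Finite S
  finite_of_mem _ _ h := h
  sub_mem _ _ _ _ f hf h := by
    have := h
    exact Finite.of_injective f hf
  image_mem _ _ _ _ f hf h := by
    have := h
    exact Finite.of_surjective f hf
  pi_mem _ _ _ h := by
    have := h
    exact Pi.finite

section Languages

variable {A : Type u}

/-- The word, as a list of letters, of an element of the free semigroup `A⁺`. -/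
def toWord (w : FreeSemigroup A) : List A := w.head :: w.tail

/-- The `+`-language `L ⊆ A⁺` is `V`-recognizable: `L = φ⁻¹ φ L` for some homomorphism `φ` from
`A⁺` into a member of `V`. -/
def Recognizable (V : Pseudovariety.{u}) (L : Set (FreeSemigroup A)) : Prop :=
  ∃ (S : Type u) (_ : Semigroup S) (φ : FreeSemigroup A →ₙ* S), V.Mem S ∧ L = φ ⁻¹' (φ '' L)

/-- `L ⊆ A*` is either a `V`-recognizable `+`-language or the language `{1}`. -/
def RecognizableOrOne (V : Pseudovariety.{u}) (L : Language A) : Prop :=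
  (∃ K : Set (FreeSemigroup A), Recognizable V K ∧ L = toWord '' K) ∨ L = {[]}

def PrefixCode (L : Language A) : Prop := ∀ x ∈ L, ∀ w : List A, w ≠ [] → x ++ w ∉ L

def SuffixCode (L : Language A) : Prop := ∀ x ∈ L, ∀ w : List A, w ≠ [] → w ++ x ∉ L

end Languages

/-- Closure under bideterministic product: over every finite alphabet, `LaK` is a `V`-recognizable
`+`-language whenever `L` and `K` are `V`-recognizable `+`-languages or `{1}`, `La` is a prefix
code and `aK` is a suffix code. -/
def Pseudovariety.ClosedUnderBideterministicProduct (V : Pseudovariety.{u}) : Prop :=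
  ∀ (A : Type u) [Finite A] (L K : Language A) (a : A),
    RecognizableOrOne V L → RecognizableOrOne V K →
    PrefixCode (L * {[a]}) → SuffixCode ({[a]} * K) →
    ∃ M : Set (FreeSemigroup A), Recognizable V M ∧ L * {[a]} * K = toWord '' M

section Free

variable (V : Pseudovariety.{u}) (A : Type u)

/-- The congruences on `A⁺` whose quotient lies in `V`. -/
def Index : Type u := {c : Con (FreeSemigroup A) // V.Mem c.Quotient}

variable {V A} in
/-- The quotient of `A⁺` by a congruence, as a discrete semigroup. -/
def Index.Carrier (c : Index V A) : Type u := c.1.Quotient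

instance (c : Index V A) : Semigroup c.Carrier := inferInstanceAs (Semigroup c.1.Quotient)

instance (c : Index V A) : TopologicalSpace c.Carrier := ⊥

instance (c : Index V A) : DiscreteTopology c.Carrier := ⟨rfl⟩

/-- The diagonal homomorphism from `A⁺` into the product of its quotients that lie in `V`. -/
def diagonal : FreeSemigroup A →ₙ* (∀ c : Index V A, c.Carrier) where
  toFun w c := (w : c.1.Quotient)
  map_mul' _ _ := rfl

/-- The free pro-`V` semigroup on `A`: the closure of the image of `A⁺` in the product of all its
discrete quotients that lie in `V`. It carries the induced multiplication and topology. -/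
def FreePro : Type u := ↥((diagonal V A).srange.topologicalClosure)

instance : Semigroup (FreePro V A) :=
  inferInstanceAs (Semigroup ↥((diagonal V A).srange.topologicalClosure))

instance : TopologicalSpace (FreePro V A) :=
  inferInstanceAs (TopologicalSpace ↥((diagonal V A).srange.topologicalClosure))

/-- The free profinite semigroup on `A`; its elements are the pseudowords. -/
abbrev FreeProfinite : Type u := FreePro allFinite.{u} A

/-- The homomorphism from `A⁺` into the free pro-`V` semigroup. -/
def ofWord : FreeSemigroup A →ₙ* FreePro V A where
  toFun w := ⟨diagonal V A w, _root_.subset_closure ⟨w, rfl⟩⟩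
  map_mul' x y := Subtype.ext (map_mul (diagonal V A) x y)

variable {A}

/-- The generating map `A → FreePro V A`. -/
def letter (a : A) : FreePro V A := ofWord V A (FreeSemigroup.of a)

/-- A congruence with quotient in `V`, seen as a congruence with finite quotient. -/
def Index.toAll (c : Index V A) : Index allFinite.{u} A :=
  ⟨c.1, V.finite_of_mem _ c.2⟩

/-- The natural projection of the free profinite semigroup onto the free pro-`V` semigroup: it
forgets the coordinates of the quotients outside `V`. -/
def projection : FreeProfinite A →ₙ* FreePro V A where
  toFun x := ⟨fun c => x.1 (Index.toAll V c), by
    have hc : Continuous (fun (y : ∀ c : Index allFinite.{u} A, c.Carrier) =>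
        (fun c : Index V A => (y (Index.toAll V c) : c.Carrier))) :=
      continuous_pi fun c => continuous_apply (Index.toAll V c)
    refine map_mem_closure hc x.2 ?_
    rintro _ ⟨w, rfl⟩
    exact ⟨w, rfl⟩⟩
  map_mul' _ _ := rfl

variable {V}

/-- The kernel congruence of the homomorphism `A⁺ → S` determined by `φ : A → S`. -/
def kernelIndex {S : Type u} [Semigroup S] (hS : V.Mem S) (φ : A → S) : Index V A :=
  ⟨Con.ker (FreeSemigroup.lift φ), V.sub_mem _ S
    { toFun := fun q => Con.liftOn q (FreeSemigroup.lift φ) fun _ _ h => h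
      map_mul' := by
        rintro ⟨x⟩ ⟨y⟩
        exact map_mul (FreeSemigroup.lift φ) x y }
    (by
      rintro ⟨x⟩ ⟨y⟩ h
      exact Quotient.sound h) hS⟩

/-- The continuous extension `FreePro V A → S` of a map `φ : A → S` into a member `S` of `V`. -/
def extend {S : Type u} [Semigroup S] (hS : V.Mem S) (φ : A → S) : FreePro V A →ₙ* S where
  toFun x := Con.liftOn (c := Con.ker (FreeSemigroup.lift φ)) (x.1 (kernelIndex hS φ))
    (FreeSemigroup.lift φ) fun _ _ h => h
  map_mul' x y := by
    change Con.liftOn (c := Con.ker (FreeSemigroup.lift φ))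
      ((x.1 (kernelIndex hS φ) : (Con.ker (FreeSemigroup.lift φ)).Quotient) *
        (y.1 (kernelIndex hS φ) : (Con.ker (FreeSemigroup.lift φ)).Quotient)) _ _ = _
    generalize (x.1 (kernelIndex hS φ)) = p
    generalize (y.1 (kernelIndex hS φ)) = q
    revert p q
    rintro ⟨p⟩ ⟨q⟩
    exact map_mul (FreeSemigroup.lift φ) p q

/-- `extend hS φ` is the unique continuous homomorphism that extends `φ`. -/
theorem extend_unique {S : Type u} [Semigroup S] [TopologicalSpace S] [DiscreteTopology S]
    (hS : V.Mem S) (φ : A → S) (f : FreePro V A →ₙ* S) :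
    (Continuous f ∧ ∀ a, f (letter V a) = φ a) ↔ f = extend hS φ := by
  have hcont : Continuous (extend hS φ) := by
    have h1 : Continuous fun x : FreePro V A => x.1 (kernelIndex hS φ) :=
      (continuous_apply (kernelIndex hS φ)).comp continuous_subtype_val
    have h2 : Continuous fun q : (kernelIndex hS φ).Carrier =>
        Con.liftOn (c := Con.ker (FreeSemigroup.lift φ)) q
          (FreeSemigroup.lift φ) fun _ _ h => h := continuous_of_discreteTopology
    exact h2.comp h1
  constructor
  · rintro ⟨hf, hφ⟩
    have hw : f.comp (ofWord V A) = (extend hS φ).comp (ofWord V A) := by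
      apply FreeSemigroup.hom_ext
      funext a
      exact hφ a
    have hd : DenseRange (ofWord V A) := by
      intro x
      refine (closure_subtype (x := x) (s := Set.range (ofWord V A))).2 ?_
      refine closure_mono ?_ x.2
      rintro _ ⟨w, rfl⟩
      exact ⟨ofWord V A w, ⟨w, rfl⟩, rfl⟩
    have := hd.equalizer hf hcont (funext fun w => DFunLike.congr_fun hw w)
    exact DFunLike.coe_injective this
  · rintro rfl
    exact ⟨hcont, fun a => rfl⟩

variable (V)

/-- `V ⊨ π = ρ`: in every member `S` of `V`, all evaluations of `π` and `ρ` coincide. -/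
def Pseudovariety.Models (π ρ : FreeProfinite A) : Prop :=
  ∀ (S : Type u) [Semigroup S] (hS : V.Mem S) (φ : A → S),
    extend (V := allFinite) (V.finite_of_mem S hS) φ π =
      extend (V := allFinite) (V.finite_of_mem S hS) φ ρ

end Free

section Green

variable {S : Type u} [Semigroup S]

/-- `s ≤_R t`, that is, `s ∈ t Sᴵ`. -/
def RLe (s t : S) : Prop := s = t ∨ ∃ x, s = t * x

/-- `s ≤_L t`, that is, `s ∈ Sᴵ t`. -/
def LLe (s t : S) : Prop := s = t ∨ ∃ x, s = x * t

def RLt (s t : S) : Prop := RLe s t ∧ ¬ RLe t s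

def LLt (s t : S) : Prop := LLe s t ∧ ¬ LLe t s

/-- `s` is a regular element, that is, `s ∈ s S s`. -/
def RegularElement (s : S) : Prop := ∃ x, s = s * x * s

end Green

section Factorizations

variable {A : Type u}

/-- `π` is `V`-multiregular: its image in the free pro-`V` semigroup is a (non-empty, finite)
product of regular elements. -/
def Multiregular (V : Pseudovariety.{u}) (π : FreeProfinite A) : Prop :=
  projection V π ∈ Subsemigroup.closure {x : FreePro V A | RegularElement x}

/-- The value of a word of `A*` in the free profinite semigroup with an identity adjoined. -/
def wordValue (w : List A) : WithOne (FreeProfinite A) :=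
  (w.map fun a => (letter allFinite a : WithOne (FreeProfinite A))).prod

/-- A factorization `π = u₀ π₁ u₁ ⋯ πₙ uₙ` with `u₀, uₙ ∈ A*`, with `uᵢ ∈ A⁺` for `0 < i < n`, and
with pseudowords `πᵢ ∉ A⁺`. Here `word i` is `uᵢ` and `block j` is `π_{j+1}`. -/
structure Factorization (n : ℕ) (π : FreeProfinite A) where
  word : Fin (n + 1) → List A
  block : Fin n → FreeProfinite A
  word_ne_nil : ∀ i, i ≠ 0 → i ≠ Fin.last n → word i ≠ []
  block_not_word : ∀ j, block j ∉ Set.range (ofWord allFinite A)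
  prod_eq : wordValue (word 0) *
    (List.ofFn fun j : Fin n =>
      (block j : WithOne (FreeProfinite A)) * wordValue (word j.succ)).prod = π

variable {n : ℕ} {π : FreeProfinite A}

/-- The factorization is multiregularly organized in `V`. -/
def Factorization.MultiregularlyOrganized (F : Factorization n π) (V : Pseudovariety.{u}) : Prop :=
  ∀ j, Multiregular V (F.block j)

/-- The factorization has short `V`-breaks: for each block `p` with neighbouring words `u p v`, one
has `[p b]_V <_R [p]_V` if `v` is non-empty with first letter `b`, and `[a p]_V <_L [p]_V` if `u`
is non-empty with last letter `a`. (Only the first and the last word can be empty.) -/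
def Factorization.ShortBreaks (F : Factorization n π) (V : Pseudovariety.{u}) : Prop :=
  ∀ j : Fin n,
    (∀ b ∈ (F.word j.succ).head?,
      RLt (projection V (F.block j * letter allFinite b)) (projection V (F.block j))) ∧
    (∀ a ∈ (F.word j.castSucc).getLast?,
      LLt (projection V (letter allFinite a * F.block j)) (projection V (F.block j)))

end Factorizations

end Profinite

/-! Call a product `x·a·y` in the free pro-`V` monoid a break if `x` falls strictly in the R-order
when multiplied by the letter `a` on the right, and `y` falls strictly in the L-order when
multiplied by `a` on the left. By compactness each fall is already visible in a finite quotient, so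
`x` and `y` have arbitrarily small recognizable neighbourhoods `L` and `K` with `La` a prefix code
and `aK` a suffix code. Closure under bideterministic product makes `LaK` the trace of a clopen set.
Hence the words close to `x·a·y` are products `lak` with `l` close to `x` and `k` close to `y`
(`approx_mul_letter_mul_le`).

Properties of words therefore pass to the limit at breaks: cancellation (`mul_left_cancel_of_falls`,
`mul_right_cancel_of_falls`) and equidivisibility (`exists_refinement`). If `s = x·a·y` were a break
with `s = s r s`, cancellation would give `y = (y r x)·a·y`, so that `y` does not fall.
Equidivisibility carries this to products of regular elements: a multiregular element contains no
break (`not_falls_of_mem_closure_regular`).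

Short breaks are local conditions, but cancellation spreads them to the whole remainder of a
factorization (`leftFalls_listValue`). Two factorizations of the same element can then be compared
from the left: if their first blocks ended at different places, one of them would contain a break of
the other factorization. So the first pieces agree, the break is cancelled, and induction finishes.
-/

namespace Profinite

open Filter Topology

/-! ### Neighbourhoods and finite quotients of the free pro-`V` semigroup -/

section Topology

variable {V : Pseudovariety.{u}} {A : Type u}

instance (c : Index V A) : Finite c.Carrier := V.finite_of_mem _ c.2

instance : T2Space (FreePro V A) :=
  inferInstanceAs (T2Space ↥((diagonal V A).srange.topologicalClosure))

instance : CompactSpace (FreePro V A) :=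
  isCompact_iff_compactSpace.1
    (Subsemigroup.isClosed_topologicalClosure (diagonal V A).srange).isCompact

instance : ContinuousMul (FreePro V A) :=
  inferInstanceAs (ContinuousMul ↥((diagonal V A).srange.topologicalClosure))

theorem denseRange_ofWord : DenseRange (ofWord V A) := by
  intro x
  refine (closure_subtype (x := x) (s := Set.range (ofWord V A))).2 ?_
  refine closure_mono ?_ x.2
  rintro _ ⟨w, rfl⟩
  exact ⟨ofWord V A w, ⟨w, rfl⟩, rfl⟩

/-- The coordinate of an element of the free pro-`V` semigroup at a quotient in `V`. -/
def coord (c : Index V A) : FreePro V A →ₙ* c.Carrier where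
  toFun x := x.1 c
  map_mul' _ _ := rfl

theorem continuous_coord (c : Index V A) : Continuous (coord c) :=
  (continuous_apply c).comp continuous_subtype_val

theorem FreePro.ext {x y : FreePro V A} (h : ∀ c : Index V A, coord c x = coord c y) : x = y :=
  Subtype.ext (funext h)

theorem con_iInf_iff {ι : Type*} {f : ι → Con (FreeSemigroup A)} {v w : FreeSemigroup A} :
    (⨅ i, f i) v w ↔ ∀ i, f i v w := by
  simp [Con.coe_iInf]

/-- The intersection of finitely many congruences with quotient in `V`. -/
def Index.iInf {n : ℕ} (c : Fin n → Index V A) : Index V A :=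
  ⟨⨅ i, (c i).1, V.sub_mem _ (∀ i, (c i).1.Quotient)
    { toFun := fun q i => Con.liftOn q (fun w => (w : (c i).1.Quotient))
        fun v w h => (Con.eq _).2 (con_iInf_iff.1 h i)
      map_mul' := by
        rintro ⟨x⟩ ⟨y⟩
        rfl }
    (by
      rintro ⟨x⟩ ⟨y⟩ h
      exact (Con.eq _).2 (con_iInf_iff.2 fun i => (Con.eq _).1 (congrFun h i)))
    (V.pi_mem n _ fun i => (c i).2)⟩

/-- The coordinate at `d` is a function of the coordinate at `c`: this holds on words, which are
dense, and both sides are continuous. -/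
theorem coord_eq_of_le {c d : Index V A} (h : c.1 ≤ d.1) {x y : FreePro V A}
    (hxy : coord c x = coord c y) : coord d x = coord d y := by
  have key : ∀ z : FreePro V A, coord d z =
      Con.liftOn (c := c.1) (coord c z) (fun w => (w : d.1.Quotient))
        (fun v w hv => (Con.eq _).2 (h hv)) := by
    have h2 : Continuous fun q : c.Carrier =>
        (Con.liftOn (c := c.1) q (fun w => (w : d.1.Quotient))
          (fun v w hv => (Con.eq _).2 (h hv)) : d.Carrier) := continuous_of_discreteTopology
    have := denseRange_ofWord.equalizer (continuous_coord d) (h2.comp (continuous_coord c))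
      (funext fun w => rfl)
    exact fun z => congrFun this z
  rw [key, key, hxy]

/-- A basic neighbourhood in the product constrains finitely many coordinates, and the intersection
of their congruences is again an index, so a single coordinate suffices. -/
theorem exists_coord_nhds {x : FreePro V A} {U : Set (FreePro V A)} (hU : U ∈ 𝓝 x) :
    ∃ c : Index V A, ∀ y, coord c y = coord c x → y ∈ U := by
  obtain ⟨W, hW, hWU⟩ := mem_nhds_subtype _ _ _ |>.1 hU
  rw [nhds_pi, Filter.mem_pi] at hW
  obtain ⟨I, hI, t, ht, htW⟩ := hW
  have := hI.to_subtype
  obtain ⟨n, ⟨e⟩⟩ := Finite.exists_equiv_fin I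
  refine ⟨Index.iInf fun i => (e.symm i : Index V A), fun y hy => hWU (htW fun c hc => ?_)⟩
  have h1 : coord c y = coord c x := by
    refine coord_eq_of_le ?_ hy
    have : (⨅ i, ((e.symm i : Index V A)).1 : Con (FreeSemigroup A)) ≤
        ((e.symm (e ⟨c, hc⟩) : Index V A)).1 := iInf_le _ (e ⟨c, hc⟩)
    rwa [Equiv.symm_apply_apply] at this
  have h2 : y.1 c = x.1 c := h1
  rw [h2]
  exact mem_of_mem_nhds (ht c)

/-- The range of `f` is compact, hence closed, so its complement is a neighbourhood of `x`. This
turns a strict fall in the free pro-`V` semigroup into one visible in a single finite quotient. -/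
theorem exists_coord_forall_ne {X : Type*} [TopologicalSpace X] [CompactSpace X]
    {x : FreePro V A} {U : Set (FreePro V A)} (hU : U ∈ 𝓝 x) {f : X → FreePro V A}
    (hf : Continuous f) (h : ∀ t, x ≠ f t) :
    ∃ c : Index V A, (∀ y, coord c y = coord c x → y ∈ U) ∧ ∀ t, coord c (f t) ≠ coord c x := by
  have h1 : (Set.range f)ᶜ ∈ 𝓝 x :=
    (isCompact_range hf).isClosed.isOpen_compl.mem_nhds fun ⟨t, ht⟩ => h t ht.symm
  obtain ⟨c, hc⟩ := exists_coord_nhds (inter_mem hU h1)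
  exact ⟨c, fun y hy => (hc y hy).1, fun t ht => (hc _ ht).2 ⟨t, rfl⟩⟩

/-- A recognizable language is the trace of an open and closed set. -/
theorem Recognizable.exists_isClopen {L : Set (FreeSemigroup A)} (hL : Recognizable V L) :
    ∃ U : Set (FreePro V A), IsClopen U ∧ L = ofWord V A ⁻¹' U := by
  obtain ⟨S, _, φ, hS, hL⟩ := hL
  let _ : TopologicalSpace S := ⊥
  have : DiscreteTopology S := ⟨rfl⟩
  set f := extend hS (fun a => φ (FreeSemigroup.of a))
  have hf : Continuous f := ((extend_unique hS _ f).2 rfl).1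
  have hw : f.comp (ofWord V A) = φ := by
    apply FreeSemigroup.hom_ext
    funext a
    exact ((extend_unique hS _ f).2 rfl).2 a
  refine ⟨f ⁻¹' (φ '' L), (isClopen_discrete _).preimage hf, ?_⟩
  rw [← Set.preimage_comp, ← MulHom.coe_comp, hw]
  exact hL

theorem recognizable_coord (c : Index V A) (q : c.Carrier) :
    Recognizable V {w : FreeSemigroup A | coord c (ofWord V A w) = q} := by
  refine ⟨c.Carrier, inferInstance, (coord c).comp (ofWord V A), c.2, ?_⟩
  ext w
  constructor
  · exact fun h => ⟨w, h, rfl⟩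
  · rintro ⟨v, hv, hvw⟩
    exact hvw.symm.trans hv

end Topology

/-! ### Approximation of elements by words -/

section Words

variable {V : Pseudovariety.{u}} {A : Type u}

theorem toWord_mul (v w : FreeSemigroup A) : toWord (v * w) = toWord v ++ toWord w := by
  simp [toWord]

theorem toWord_of (a : A) : toWord (FreeSemigroup.of a) = [a] := rfl

theorem toWord_ne_nil (w : FreeSemigroup A) : toWord w ≠ [] := by simp [toWord]

theorem toWord_injective : Function.Injective (toWord : FreeSemigroup A → List A) := by
  rintro ⟨a, s⟩ ⟨b, t⟩ h
  simpa [toWord] using h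

theorem exists_toWord {w : List A} (hw : w ≠ []) : ∃ v : FreeSemigroup A, toWord v = w := by
  cases w with
  | nil => exact absurd rfl hw
  | cons a s => exact ⟨⟨a, s⟩, rfl⟩

/-- The filter of the words that approximate an element of the free pro-`V` monoid, in which the
identity is isolated. -/
def approx (x : WithOne (FreePro V A)) : Filter (List A) :=
  WithOne.recOneCoe (pure []) (fun z => map toWord (comap (ofWord V A) (𝓝 z))) x

theorem approx_one : approx (1 : WithOne (FreePro V A)) = pure [] := rfl

theorem approx_coe (z : FreePro V A) :
    approx (z : WithOne (FreePro V A)) = map toWord (comap (ofWord V A) (𝓝 z)) := rfl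

theorem mem_approx_coe {z : FreePro V A} {L : Set (List A)} :
    L ∈ approx (z : WithOne (FreePro V A)) ↔
      ∃ U ∈ 𝓝 z, ∀ w, ofWord V A w ∈ U → toWord w ∈ L := by
  rw [approx_coe, mem_map, mem_comap]
  rfl

theorem image_mem_approx {z : FreePro V A} {U : Set (FreePro V A)} (hU : U ∈ 𝓝 z) :
    toWord '' (ofWord V A ⁻¹' U) ∈ approx (z : WithOne (FreePro V A)) :=
  mem_approx_coe.2 ⟨U, hU, fun w hw => ⟨w, hw, rfl⟩⟩

instance (x : WithOne (FreePro V A)) : (approx x).NeBot := by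
  induction x using WithOne.recOneCoe with
  | one => rw [approx_one]; infer_instance
  | coe z =>
    rw [approx_coe]
    have : (comap (ofWord V A) (𝓝 z)).NeBot :=
      comap_neBot fun U hU => by
        obtain ⟨_, h, w, rfl⟩ := mem_closure_iff_nhds.1 (denseRange_ofWord z) U hU
        exact ⟨w, h⟩
    infer_instance

theorem map₂_approx_le (x y : WithOne (FreePro V A)) :
    map₂ (· ++ ·) (approx x) (approx y) ≤ approx (x * y) := by
  induction x using WithOne.recOneCoe with
  | one => simp [approx_one, map₂_pure_left]
  | coe x =>
    induction y using WithOne.recOneCoe with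
    | one => simp [approx_one, map₂_pure_right]
    | coe y =>
      rw [← WithOne.coe_mul]
      intro L hL
      obtain ⟨U, hU, hUL⟩ := mem_approx_coe.1 hL
      have h := (continuous_mul.tendsto (x, y)) hU
      rw [mem_map, nhds_prod_eq, mem_prod_iff] at h
      obtain ⟨U₁, h₁, U₂, h₂, h⟩ := h
      refine mem_map₂_iff.2 ⟨_, image_mem_approx h₁,
        _, image_mem_approx h₂, ?_⟩
      rintro _ ⟨_, ⟨v, hv, rfl⟩, _, ⟨w, hw, rfl⟩, rfl⟩
      have := hUL (v * w) (by rw [map_mul]; exact h (Set.mk_mem_prod hv hw))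
      rwa [toWord_mul] at this

/-- A letter as an element of the free pro-`V` monoid. -/
def letterOne (V : Pseudovariety.{u}) (a : A) : WithOne (FreePro V A) := (letter V a : FreePro V A)

theorem pure_le_approx_letter (a : A) : pure [a] ≤ approx (letterOne V a) := by
  intro L hL
  obtain ⟨U, hU, hUL⟩ := mem_approx_coe.1 hL
  exact hUL (FreeSemigroup.of a) (mem_of_mem_nhds hU)

theorem map₂_cons_approx_le (x y : WithOne (FreePro V A)) (a : A) :
    map₂ (fun l k => l ++ a :: k) (approx x) (approx y) ≤ approx (x * (letterOne V a * y)) := by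
  refine le_trans ?_ (map₂_approx_le x (letterOne V a * y))
  refine le_trans ?_ (map₂_mono le_rfl (map₂_approx_le (letterOne V a) y))
  refine le_trans ?_ (map₂_mono le_rfl (map₂_mono (pure_le_approx_letter a) le_rfl))
  rw [map₂_pure_left, map₂_map_right]
  exact le_rfl

/-- Compactness of the free pro-`V` monoid, in terms of words; the empty word is split off because
it converges to the isolated identity. -/
theorem exists_le_approx (f : Ultrafilter (List A)) :
    ∃ x : WithOne (FreePro V A), ↑f ≤ approx x := by
  by_cases h : {[]} ∈ f
  · exact ⟨1, by rw [approx_one]; exact le_pure_iff.2 h⟩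
  · have hr : Set.range (toWord : FreeSemigroup A → List A) ∈ f := by
      refine mem_of_superset (Ultrafilter.compl_mem_iff_notMem.2 h) fun w hw => ?_
      obtain ⟨v, hv⟩ := exists_toWord hw
      exact ⟨v, hv⟩
    let g : Ultrafilter (FreeSemigroup A) := f.comap toWord_injective hr
    obtain ⟨z, -, hz⟩ := isCompact_univ.ultrafilter_le_nhds (g.map (ofWord V A)) (by simp)
    refine ⟨z, ?_⟩
    rw [approx_coe]
    have hg : (g : Filter (FreeSemigroup A)) = comap toWord f := rfl
    have : (f : Filter (List A)) = map toWord (g : Filter (FreeSemigroup A)) := by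
      rw [hg, map_comap_of_mem hr]
    rw [this]
    exact map_mono (map_le_iff_le_comap.1 hz)

/-- Uniqueness of limits: the Hausdorff property of the free pro-`V` monoid, in terms of words. -/
theorem eq_of_le_approx {f : Filter (List A)} [f.NeBot] {x y : WithOne (FreePro V A)}
    (hx : f ≤ approx x) (hy : f ≤ approx y) : x = y := by
  have key : ∀ z : FreePro V A, {w : List A | w ≠ []} ∈ approx (z : WithOne (FreePro V A)) :=
    fun z => mem_approx_coe.2 ⟨Set.univ, univ_mem, fun w _ => toWord_ne_nil w⟩
  have key1 : {w : List A | w = []} ∈ approx (1 : WithOne (FreePro V A)) := by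
    rw [approx_one]; exact rfl
  induction x using WithOne.recOneCoe with
  | one =>
    induction y using WithOne.recOneCoe with
    | one => rfl
    | coe y =>
      obtain ⟨w, h1, h2⟩ := nonempty_of_mem (inter_mem (hx key1) (hy (key y)))
      exact absurd h1 h2
  | coe x =>
    induction y using WithOne.recOneCoe with
    | one =>
      obtain ⟨w, h1, h2⟩ := nonempty_of_mem (inter_mem (hx (key x)) (hy key1))
      exact absurd h2 h1
    | coe y =>
      by_contra hne
      have hne : x ≠ y := fun h => hne (by rw [h])
      obtain ⟨U, W, hU, hW, hxU, hyW, hd⟩ := t2_separation hne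
      obtain ⟨_, ⟨v, hv, rfl⟩, w, hw, hvw⟩ := nonempty_of_mem (inter_mem
        (hx (image_mem_approx (hU.mem_nhds hxU)))
        (hy (image_mem_approx (hW.mem_nhds hyW))))
      rw [toWord_injective hvw] at hw
      exact Set.disjoint_left.1 hd hv hw

end Words

/-! ### Cancellation and equidivisibility at breaks -/

section Breaks

variable {V : Pseudovariety.{u}} {A : Type u}

/-- The element `x` falls strictly in the `R`-order when multiplied by `a` on the right. -/
def RightFalls (x : WithOne (FreePro V A)) (a : A) : Prop :=
  ∀ t : WithOne (FreePro V A), x ≠ x * (letterOne V a * t)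

/-- The element `y` falls strictly in the `L`-order when multiplied by `a` on the left. -/
def LeftFalls (a : A) (y : WithOne (FreePro V A)) : Prop :=
  ∀ t : WithOne (FreePro V A), y ≠ t * (letterOne V a * y)

theorem one_ne_mul_letter_mul (a : A) (s t : WithOne (FreePro V A)) :
    (1 : WithOne (FreePro V A)) ≠ s * (letterOne V a * t) := by
  unfold letterOne
  induction s using WithOne.recOneCoe <;> induction t using WithOne.recOneCoe <;>
    simp only [one_mul, mul_one, ← WithOne.coe_mul] <;> exact (WithOne.coe_ne_one).symm

theorem rightFalls_one (a : A) : RightFalls (1 : WithOne (FreePro V A)) a :=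
  fun _ => one_ne_mul_letter_mul a _ _

theorem leftFalls_one (a : A) : LeftFalls a (1 : WithOne (FreePro V A)) :=
  fun _ => one_ne_mul_letter_mul a _ _

theorem RightFalls.of_mul_left {s x : WithOne (FreePro V A)} {a : A} (h : RightFalls (s * x) a) :
    RightFalls x a := by
  intro t ht
  refine h t ?_
  rw [mul_assoc, ← ht]

theorem LeftFalls.of_mul_right {s y : WithOne (FreePro V A)} {a : A} (h : LeftFalls a (y * s)) :
    LeftFalls a y := by
  intro t ht
  refine h t ?_
  rw [← mul_assoc, ← mul_assoc, mul_assoc t, ← ht]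

theorem recognizableOrOne_one : RecognizableOrOne V ({[]} : Language A) := Or.inr rfl

/-- The language is the class of `x` in a finite quotient fine enough to see the fall. If `v` and
`v·a·t` were both in the class, then `x` and `x·a·t` would have the same image there. -/
theorem RightFalls.exists_prefixCode {x : WithOne (FreePro V A)} {a : A} (h : RightFalls x a)
    {L : Set (List A)} (hL : L ∈ approx x) :
    ∃ K : Language A, K ∈ approx x ∧ (∀ w ∈ K, w ∈ L) ∧ RecognizableOrOne V K ∧
      PrefixCode (K * {[a]}) := by
  induction x using WithOne.recOneCoe with
  | one =>
    rw [approx_one] at hL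
    refine ⟨({[]} : Set (List A)), by rw [approx_one]; exact rfl, ?_, recognizableOrOne_one, ?_⟩
    · rintro w rfl
      exact hL
    · rintro _ ⟨_, rfl, _, rfl, rfl⟩ w hw ⟨_, rfl, _, rfl, h⟩
      simp at h
      exact hw h
  | coe z =>
    obtain ⟨U, hU, hUL⟩ := mem_approx_coe.1 hL
    -- The compact family `z·a·t` below has `t` in the semigroup, without identity; this
    -- neighbourhood takes care of `t = 1`.
    have h1 : {z * letter V a}ᶜ ∈ 𝓝 z := by
      refine isOpen_compl_singleton.mem_nhds fun hz => h 1 ?_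
      rw [mul_one]
      exact congrArg WithOne.coe hz
    obtain ⟨c, hcU, hc⟩ := exists_coord_forall_ne (inter_mem hU h1)
      (f := fun t => z * (letter V a * t)) (by fun_prop)
      (fun t ht => h t (congrArg WithOne.coe ht))
    refine ⟨toWord '' {w : FreeSemigroup A | coord c (ofWord V A w) = coord c z}, ?_, ?_,
      Or.inl ⟨_, recognizable_coord c _, rfl⟩, ?_⟩
    · refine image_mem_approx (U := {y | coord c y = coord c z}) ?_
      exact ((isOpen_discrete {coord c z}).preimage (continuous_coord c)).mem_nhds rfl
    · rintro _ ⟨w, hw, rfl⟩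
      exact hUL w (hcU _ hw).1
    · rintro _ ⟨_, ⟨v, hv, rfl⟩, _, rfl, rfl⟩ w hw ⟨_, ⟨v', hv', rfl⟩, _, rfl, h⟩
      obtain ⟨t, b, rfl⟩ := w.eq_nil_or_concat.resolve_left hw
      have h : toWord v' ++ [a] = (toWord v ++ a :: t) ++ [b] := by simpa using h
      obtain ⟨h, -⟩ := List.append_inj' h rfl
      rcases eq_or_ne t [] with rfl | ht
      · have h : v' = v * FreeSemigroup.of a := toWord_injective (by
          rw [toWord_mul, toWord_of, h])
        have h2 : coord c (z * letter V a) = coord c z := by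
          rw [map_mul, ← (show coord c (ofWord V A v) = _ from hv), ← map_mul]
          have he : coord c (ofWord V A v') = coord c (ofWord V A v) := hv'.trans hv.symm
          rwa [h, map_mul (ofWord V A)] at he
        exact (hcU _ h2).2 rfl
      · obtain ⟨t, rfl⟩ := exists_toWord ht
        have h : v' = v * (FreeSemigroup.of a * t) := toWord_injective (by
          rw [toWord_mul, toWord_mul, toWord_of, h]; rfl)
        apply hc (ofWord V A t)
        rw [map_mul, ← (show coord c (ofWord V A v) = _ from hv), ← map_mul]
        have he : coord c (ofWord V A v') = coord c (ofWord V A v) := hv'.trans hv.symm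
        rwa [h, map_mul (ofWord V A), map_mul (ofWord V A)] at he

theorem LeftFalls.exists_suffixCode {y : WithOne (FreePro V A)} {a : A} (h : LeftFalls a y)
    {L : Set (List A)} (hL : L ∈ approx y) :
    ∃ K : Language A, K ∈ approx y ∧ (∀ w ∈ K, w ∈ L) ∧ RecognizableOrOne V K ∧
      SuffixCode ({[a]} * K) := by
  induction y using WithOne.recOneCoe with
  | one =>
    rw [approx_one] at hL
    refine ⟨({[]} : Set (List A)), by rw [approx_one]; exact rfl, ?_, recognizableOrOne_one, ?_⟩
    · rintro w rfl
      exact hL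
    · rintro _ ⟨_, rfl, _, rfl, rfl⟩ w hw ⟨_, rfl, _, rfl, h⟩
      have := congrArg List.length h
      simp at this
      exact hw this
  | coe z =>
    obtain ⟨U, hU, hUL⟩ := mem_approx_coe.1 hL
    have h1 : {letter V a * z}ᶜ ∈ 𝓝 z := by
      refine isOpen_compl_singleton.mem_nhds fun hz => h 1 ?_
      rw [one_mul]
      exact congrArg WithOne.coe hz
    obtain ⟨c, hcU, hc⟩ := exists_coord_forall_ne (inter_mem hU h1)
      (f := fun t => t * (letter V a * z)) (by fun_prop)
      (fun t ht => h t (congrArg WithOne.coe ht))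
    refine ⟨toWord '' {w : FreeSemigroup A | coord c (ofWord V A w) = coord c z}, ?_, ?_,
      Or.inl ⟨_, recognizable_coord c _, rfl⟩, ?_⟩
    · refine image_mem_approx (U := {y | coord c y = coord c z}) ?_
      exact ((isOpen_discrete {coord c z}).preimage (continuous_coord c)).mem_nhds rfl
    · rintro _ ⟨w, hw, rfl⟩
      exact hUL w (hcU _ hw).1
    · rintro _ ⟨_, rfl, _, ⟨v, hv, rfl⟩, rfl⟩ w hw ⟨_, rfl, _, ⟨v', hv', rfl⟩, h⟩
      obtain ⟨b, t, rfl⟩ := List.exists_cons_of_ne_nil hw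
      have h : a :: toWord v' = b :: (t ++ a :: toWord v) := by simpa using h
      obtain ⟨-, h⟩ := List.cons.inj h
      rcases eq_or_ne t [] with rfl | ht
      · have h : v' = FreeSemigroup.of a * v := toWord_injective (by
          rw [toWord_mul, toWord_of, h]; rfl)
        have h2 : coord c (letter V a * z) = coord c z := by
          rw [map_mul, ← (show coord c (ofWord V A v) = _ from hv), ← map_mul]
          have he : coord c (ofWord V A v') = coord c (ofWord V A v) := hv'.trans hv.symm
          rwa [h, map_mul (ofWord V A)] at he
        exact (hcU _ h2).2 rfl
      · obtain ⟨t, rfl⟩ := exists_toWord ht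
        have h : v' = t * (FreeSemigroup.of a * v) := toWord_injective (by
          rw [toWord_mul, toWord_mul, toWord_of, h]; rfl)
        apply hc (ofWord V A t)
        rw [map_mul, map_mul, ← (show coord c (ofWord V A v) = _ from hv), ← map_mul, ← map_mul]
        have he : coord c (ofWord V A v') = coord c (ofWord V A v) := hv'.trans hv.symm
        rwa [h, map_mul (ofWord V A), map_mul (ofWord V A)] at he

theorem coe_eq_mul_letter_mul (a : A) (x y : WithOne (FreePro V A)) :
    ∃ z : FreePro V A, x * (letterOne V a * y) = z :=
  (WithOne.ne_one_iff_exists.1 (one_ne_mul_letter_mul a x y).symm).imp fun _ h => h.symm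

variable [Finite A]

/-- A bideterministic product of neighbourhoods is a neighbourhood. -/
theorem approx_mul_letter_mul_le (hV : V.ClosedUnderBideterministicProduct)
    {x y : WithOne (FreePro V A)} {a : A} (hx : RightFalls x a) (hy : LeftFalls a y) :
    approx (x * (letterOne V a * y)) ≤ map₂ (fun l k => l ++ a :: k) (approx x) (approx y) := by
  intro S hS
  obtain ⟨L, hL, K, hK, hLK⟩ := mem_map₂_iff.1 hS
  obtain ⟨L', hL', hLL, hLr, hLp⟩ := hx.exists_prefixCode hL
  obtain ⟨K', hK', hKK, hKr, hKp⟩ := hy.exists_suffixCode hK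
  obtain ⟨M, hM, hLM⟩ := hV A L' K' a hLr hKr hLp hKp
  obtain ⟨U, hU, rfl⟩ := hM.exists_isClopen
  have hmem : Set.image2 (fun l k => l ++ a :: k) L' K' ∈
      map₂ (fun l k => l ++ a :: k) (approx x) (approx y) := image2_mem_map₂ hL' hK'
  have hprod : ∀ l ∈ L', ∀ k ∈ K', l ++ a :: k ∈ toWord '' (ofWord V A ⁻¹' U) := by
    intro l hl k hk
    rw [← hLM]
    exact ⟨_, ⟨l, hl, [a], rfl, rfl⟩, k, hk, by simp⟩
  have hprod' : ∀ w ∈ toWord '' (ofWord V A ⁻¹' U), w ∈ S := by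
    intro w hw
    rw [← hLM] at hw
    obtain ⟨_, ⟨l, hl, _, rfl, rfl⟩, k, hk, rfl⟩ := hw
    exact hLK ⟨l, hLL l hl, k, hKK k hk, by simp⟩
  obtain ⟨z, hz⟩ := coe_eq_mul_letter_mul a x y
  have hle := map₂_cons_approx_le x y a
  rw [hz] at hle ⊢
  -- Otherwise the complement of `U` would be a neighbourhood of `z`, hence would contain some `l a
  -- k` with `l ∈ L'` and `k ∈ K'`; but all of these lie in `U`.
  have hzU : z ∈ U := by
    by_contra hzU
    have h2 := hle (image_mem_approx (hU.compl.isOpen.mem_nhds hzU))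
    obtain ⟨_, ⟨v, hv, rfl⟩, l, hl, k, hk, h⟩ := nonempty_of_mem (inter_mem h2 hmem)
    obtain ⟨w, hw, hwv⟩ := hprod l hl k hk
    rw [toWord_injective (hwv.trans h)] at hw
    exact hv hw
  exact mem_of_superset (image_mem_approx (hU.isOpen.mem_nhds hzU)) hprod'

/-- Take `l` close to `x` in `L`, with `La` a prefix code, and `k` close to `y'`. Then `lak` is
close to `x·a·y`, so it lies in `LaK`, and the prefix code forces `k ∈ K`. Nothing is asked of `y'`,
which matters in the application to regular elements. -/
theorem mul_left_cancel_of_falls (hV : V.ClosedUnderBideterministicProduct)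
    {x y y' : WithOne (FreePro V A)} {a : A} (hx : RightFalls x a) (hy : LeftFalls a y)
    (h : x * (letterOne V a * y) = x * (letterOne V a * y')) : y = y' := by
  refine eq_of_le_approx (f := approx y') (fun K hK => ?_) le_rfl
  obtain ⟨L, hL, -, -, hLp⟩ := hx.exists_prefixCode univ_mem
  have h1 := (map₂_cons_approx_le x y' a).trans (h ▸ approx_mul_letter_mul_le hV hx hy)
    (image2_mem_map₂ hL hK)
  obtain ⟨L₁, hL₁, K₁, hK₁, hsub⟩ := mem_map₂_iff.1 h1
  obtain ⟨l, hl₁, hl⟩ := nonempty_of_mem (inter_mem hL₁ hL)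
  refine mem_of_superset hK₁ fun k hk => ?_
  obtain ⟨l₀, hl₀, k₀, hk₀, he⟩ := hsub ⟨l, hl₁, k, hk, rfl⟩
  have he : (l₀ ++ [a]) ++ k₀ = (l ++ [a]) ++ k := by simpa using he
  have hm : ∀ w ∈ L, w ++ [a] ∈ L * ({[a]} : Language A) := fun w hw => ⟨w, hw, [a], rfl, rfl⟩
  have hk : k₀ = k := by
    rcases List.append_eq_append_iff.1 he with ⟨t, ht, ht'⟩ | ⟨t, ht, ht'⟩
    · rcases eq_or_ne t [] with rfl | hne
      · exact ht'
      · exact absurd (ht ▸ hm l hl) (hLp _ (hm l₀ hl₀) t hne)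
    · rcases eq_or_ne t [] with rfl | hne
      · exact ht'.symm
      · exact absurd (ht ▸ hm l₀ hl₀) (hLp _ (hm l hl) t hne)
  exact hk ▸ hk₀

theorem mul_right_cancel_of_falls (hV : V.ClosedUnderBideterministicProduct)
    {x x' y : WithOne (FreePro V A)} {a : A} (hx : RightFalls x a) (hy : LeftFalls a y)
    (h : x * (letterOne V a * y) = x' * (letterOne V a * y)) : x = x' := by
  refine eq_of_le_approx (f := approx x') (fun L hL => ?_) le_rfl
  obtain ⟨K, hK, -, -, hKs⟩ := hy.exists_suffixCode univ_mem
  have h1 := (map₂_cons_approx_le x' y a).trans (h ▸ approx_mul_letter_mul_le hV hx hy)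
    (image2_mem_map₂ hL hK)
  obtain ⟨L₁, hL₁, K₁, hK₁, hsub⟩ := mem_map₂_iff.1 h1
  obtain ⟨k, hk₁, hk⟩ := nonempty_of_mem (inter_mem hK₁ hK)
  refine mem_of_superset hL₁ fun l hl => ?_
  obtain ⟨l₀, hl₀, k₀, hk₀, he⟩ := hsub ⟨l, hl, k, hk₁, rfl⟩
  have hm : ∀ w ∈ K, a :: w ∈ ({[a]} : Language A) * K := fun w hw => ⟨[a], rfl, w, hw, rfl⟩
  have hl : l₀ = l := by
    rcases List.append_eq_append_iff.1 he with ⟨t, ht, ht'⟩ | ⟨t, ht, ht'⟩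
    · rcases eq_or_ne t [] with rfl | hne
      · simpa using ht.symm
      · exact absurd (ht' ▸ hm k₀ hk₀) (hKs _ (hm k hk) t hne)
    · rcases eq_or_ne t [] with rfl | hne
      · simpa using ht
      · exact absurd (ht' ▸ hm k hk) (hKs _ (hm k₀ hk₀) t hne)
  exact hl ▸ hl₀

/-- Limit form of the equidivisibility of words: in `uv = lak` the marked letter `a` lies in `u` or
in `v`. -/
theorem exists_refinement (hV : V.ClosedUnderBideterministicProduct)
    {x y p q : WithOne (FreePro V A)} {a : A} (hx : RightFalls x a) (hy : LeftFalls a y)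
    (h : x * (letterOne V a * y) = p * q) :
    (∃ t, p = x * (letterOne V a * t) ∧ y = t * q) ∨
      ∃ t, x = p * t ∧ q = t * (letterOne V a * y) := by
  let f : Filter ((List A × List A) × (List A × List A)) :=
    ((approx p ×ˢ approx q) ×ˢ (approx x ×ˢ approx y)) ⊓
      𝓟 {w : (List A × List A) × (List A × List A) | w.1.1 ++ w.1.2 = w.2.1 ++ a :: w.2.2}
  -- Products of words close to `p` and `q` are close to `x·a·y`, so they have the form `lak` with
  -- `l` and `k` close to `x` and `y`.
  have hf : f.NeBot := by
    rw [inf_principal_neBot_iff]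
    intro W hW
    obtain ⟨W₁, hW₁, W₂, hW₂, hW⟩ := mem_prod_iff.1 hW
    obtain ⟨P, hP, Q, hQ, hPQ⟩ := mem_prod_iff.1 hW₁
    obtain ⟨L, hL, K, hK, hLK⟩ := mem_prod_iff.1 hW₂
    have h1 := (map₂_approx_le p q).trans (h ▸ approx_mul_letter_mul_le hV hx hy)
      (image2_mem_map₂ hL hK)
    obtain ⟨_, ⟨u, hu, v, hv, rfl⟩, l, hl, k, hk, he⟩ :=
      nonempty_of_mem (inter_mem (image2_mem_map₂ hP hQ) h1)
    exact ⟨((u, v), (l, k)), hW ⟨hPQ ⟨hu, hv⟩, hLK ⟨hl, hk⟩⟩, he.symm⟩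
  let g := Ultrafilter.of f
  have hg : (g : Filter ((List A × List A) × (List A × List A))) ≤ f := Ultrafilter.of_le f
  have hprod := hg.trans inf_le_left
  have hp : map (fun w => w.1.1) (g : Filter ((List A × List A) × (List A × List A))) ≤ approx p :=
    (map_mono hprod).trans (tendsto_fst.comp tendsto_fst)
  have hq : map (fun w => w.1.2) (g : Filter ((List A × List A) × (List A × List A))) ≤ approx q :=
    (map_mono hprod).trans (tendsto_snd.comp tendsto_fst)
  have hl : map (fun w => w.2.1) (g : Filter ((List A × List A) × (List A × List A))) ≤ approx x :=
    (map_mono hprod).trans (tendsto_fst.comp tendsto_snd)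
  have hk : map (fun w => w.2.2) (g : Filter ((List A × List A) × (List A × List A))) ≤ approx y :=
    (map_mono hprod).trans (tendsto_snd.comp tendsto_snd)
  have heq : ∀ᶠ w in (g : Filter ((List A × List A) × (List A × List A))),
      w.1.1 ++ w.1.2 = w.2.1 ++ a :: w.2.2 :=
    (hg.trans inf_le_right) (mem_principal_self _)
  have hcases : ∀ᶠ w in (g : Filter ((List A × List A) × (List A × List A))),
      (∃ t, w.1.1 = w.2.1 ++ a :: t ∧ w.2.2 = t ++ w.1.2) ∨
        ∃ t, w.2.1 = w.1.1 ++ t ∧ w.1.2 = t ++ a :: w.2.2 := by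
    filter_upwards [heq] with w hw
    rcases List.append_eq_append_iff.1 hw with ⟨t, ht, ht'⟩ | ⟨t, ht, ht'⟩
    · exact Or.inr ⟨t, ht, ht'⟩
    · cases t with
      -- A cut just before the marked letter counts as the letter lying in the second factor.
      | nil => exact Or.inr ⟨[], by simpa using ht.symm, by simpa using ht'.symm⟩
      | cons b t =>
        have hab := (List.cons.inj ht').1
        exact Or.inl ⟨t, hab ▸ ht, (List.cons.inj ht').2⟩
  -- The ultrafilter selects one of the two cases; the required `t` is then a limit of the middle
  -- words along it.
  rcases Ultrafilter.eventually_or.1 hcases with hc | hc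
  · left
    obtain ⟨τ, hτ⟩ := hc.choice
    obtain ⟨t, ht⟩ := exists_le_approx (V := V) (g.map τ)
    refine ⟨t, eq_of_le_approx hp (le_trans ?_ (map₂_cons_approx_le x t a)),
      eq_of_le_approx hk (le_trans ?_ (map₂_approx_le t q))⟩
    · rw [map_congr (hτ.mono fun w hw => hw.1), ← map_prod_eq_map₂]
      exact (tendsto_map (f := fun w : List A × List A => w.1 ++ a :: w.2)).comp
        (Tendsto.prodMk hl ht)
    · rw [map_congr (hτ.mono fun w hw => hw.2), ← map_prod_eq_map₂]
      exact (tendsto_map (f := fun w : List A × List A => w.1 ++ w.2)).comp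
        (Tendsto.prodMk ht hq)
  · right
    obtain ⟨τ, hτ⟩ := hc.choice
    obtain ⟨t, ht⟩ := exists_le_approx (V := V) (g.map τ)
    refine ⟨t, eq_of_le_approx hl (le_trans ?_ (map₂_approx_le p t)),
      eq_of_le_approx hq (le_trans ?_ (map₂_cons_approx_le t y a))⟩
    · rw [map_congr (hτ.mono fun w hw => hw.1), ← map_prod_eq_map₂]
      exact (tendsto_map (f := fun w : List A × List A => w.1 ++ w.2)).comp
        (Tendsto.prodMk hp ht)
    · rw [map_congr (hτ.mono fun w hw => hw.2), ← map_prod_eq_map₂]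
      exact (tendsto_map (f := fun w : List A × List A => w.1 ++ a :: w.2)).comp
        (Tendsto.prodMk ht hk)

/-- A product of regular elements does not factorize at a letter where both sides fall. -/
theorem not_falls_of_mem_closure_regular (hV : V.ClosedUnderBideterministicProduct)
    {s : FreePro V A} (hs : s ∈ Subsemigroup.closure {x : FreePro V A | RegularElement x}) :
    ∀ (x y : WithOne (FreePro V A)) (a : A), RightFalls x a → LeftFalls a y →
      x * (letterOne V a * y) ≠ s := by
  induction hs using Subsemigroup.closure_induction with
  | mem s hs =>
    intro x y a hx hy h
    obtain ⟨r, hr⟩ := hs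
    have h1 : x * (letterOne V a * y) =
        x * (letterOne V a * (y * r * (x * (letterOne V a * y)))) := by
      have : (s : WithOne (FreePro V A)) = s * r * s := congrArg WithOne.coe hr
      rw [← h] at this
      simpa only [mul_assoc] using this
    have h2 := mul_left_cancel_of_falls hV hx hy h1
    exact hy (y * r * x) (by simpa only [mul_assoc] using h2)
  | mul s₁ s₂ _ _ ih₁ ih₂ =>
    intro x y a hx hy h
    rcases exists_refinement hV hx hy (h.trans (WithOne.coe_mul s₁ s₂)) with
      ⟨t, ht, rfl⟩ | ⟨t, rfl, ht⟩
    · exact ih₁ x t a hx hy.of_mul_right ht.symm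
    · exact ih₂ t y a hx.of_mul_left hy ht.symm

/-- The identity falls at every letter, so `1·a·y` is a break and all words close to it begin with
`a`. -/
theorem letter_cons_inj (hV : V.ClosedUnderBideterministicProduct) {a b : A}
    {y y' : WithOne (FreePro V A)} (hy : LeftFalls a y)
    (h : letterOne V a * y = letterOne V b * y') : a = b ∧ y = y' := by
  have h1 : approx (letterOne V b * y') ≤ map (a :: ·) (approx y) := by
    have := approx_mul_letter_mul_le hV (rightFalls_one a) hy
    rwa [one_mul, approx_one, map₂_pure_left, h] at this
  have h2 : map (b :: ·) (approx y') ≤ map (a :: ·) (approx y) := by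
    refine le_trans ?_ h1
    have := map₂_cons_approx_le 1 y' b
    rwa [one_mul, approx_one, map₂_pure_left] at this
  have hab : a = b := by
    have h3 : {w : List A | ∃ k, w = a :: k} ∈ map (a :: ·) (approx y) :=
      mem_map.2 (univ_mem' fun k => ⟨k, rfl⟩)
    obtain ⟨k, l, hl⟩ := nonempty_of_mem (mem_map.1 (h2 h3))
    exact (List.cons.inj hl).1.symm
  subst hab
  exact ⟨rfl, mul_left_cancel_of_falls hV (rightFalls_one a) hy (by rw [h])⟩

end Breaks

/-! ### Uniqueness for lists of letters and multiregular blocks -/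

section Pieces

variable {V : Pseudovariety.{u}} {A : Type u}

/-- The value in the free pro-`V` monoid of a list of letters and elements. -/
def listValue (l : List (A ⊕ FreePro V A)) : WithOne (FreePro V A) :=
  (l.map (Sum.elim (letterOne V) WithOne.coe)).prod

@[simp] theorem listValue_nil : listValue ([] : List (A ⊕ FreePro V A)) = 1 := rfl

@[simp] theorem listValue_inl (a : A) (l : List (A ⊕ FreePro V A)) :
    listValue (Sum.inl a :: l) = letterOne V a * listValue l := by simp [listValue]

@[simp] theorem listValue_inr (p : FreePro V A) (l : List (A ⊕ FreePro V A)) :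
    listValue (Sum.inr p :: l) = p * listValue l := by simp [listValue]

theorem listValue_append (l k : List (A ⊕ FreePro V A)) :
    listValue (l ++ k) = listValue l * listValue k := by simp [listValue]

/-- Two pieces of a factorization with short breaks may stand next to each other. -/
def Adjacent : A ⊕ FreePro V A → A ⊕ FreePro V A → Prop
  | Sum.inl _, Sum.inl _ => True
  | Sum.inl a, Sum.inr p => LeftFalls a (p : WithOne (FreePro V A))
  | Sum.inr p, Sum.inl b => RightFalls (p : WithOne (FreePro V A)) b
  | Sum.inr _, Sum.inr _ => False

theorem coe_mul_ne_one (p : FreePro V A) (t : WithOne (FreePro V A)) :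
    (p : WithOne (FreePro V A)) * t ≠ 1 := by
  induction t using WithOne.recOneCoe with
  | one => rw [mul_one]; exact WithOne.coe_ne_one
  | coe t => rw [← WithOne.coe_mul]; exact WithOne.coe_ne_one

theorem eq_one_of_mul_eq_one {s t : WithOne (FreePro V A)} (h : s * t = 1) : s = 1 := by
  induction s using WithOne.recOneCoe with
  | one => rfl
  | coe s => exact absurd h (coe_mul_ne_one s t)

theorem listValue_cons_ne_one (x : A ⊕ FreePro V A) (l : List (A ⊕ FreePro V A)) :
    listValue (x :: l) ≠ 1 := by
  cases x with
  | inl a => rw [listValue_inl]; exact coe_mul_ne_one _ _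
  | inr p => rw [listValue_inr]; exact coe_mul_ne_one _ _

variable [Finite A]

/-- Adjacency gives a fall only on the next block `p`. If `p·b·z = s·a·p·b·z`, where `z` is the
value of the rest after `b`, right cancellation at the break `b` leaves `p = s·a·p`, against the
fall of `p`. When a letter follows directly, the same cancellation leaves `1 = s·a`. -/
theorem leftFalls_listValue (hV : V.ClosedUnderBideterministicProduct) :
    ∀ (l : List (A ⊕ FreePro V A)) (a : A), (Sum.inl a :: l).IsChain Adjacent →
      LeftFalls a (listValue l)
  | [], a, _ => leftFalls_one a
  | Sum.inl b :: l, a, h => by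
    intro s hs
    have hb := leftFalls_listValue hV l b h.tail
    rw [listValue_inl] at hs
    have := mul_right_cancel_of_falls hV (x := 1) (x' := s * letterOne V a)
      (rightFalls_one b) hb (by simpa only [one_mul, mul_assoc] using hs)
    exact one_ne_mul_letter_mul a s 1 (by rwa [mul_one])
  | [Sum.inr p], a, h => by
    have h : Adjacent (Sum.inl a) (Sum.inr p : A ⊕ FreePro V A) :=
      (List.isChain_cons_cons.1 h).1
    rw [listValue_inr, listValue_nil, mul_one]
    exact h
  | Sum.inr p :: Sum.inl b :: l, a, h => by
    intro s hs
    have hb := leftFalls_listValue hV l b h.tail.tail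
    have hp : LeftFalls a (p : WithOne (FreePro V A)) := (List.isChain_cons_cons.1 h).1
    have hpb : RightFalls (p : WithOne (FreePro V A)) b := (List.isChain_cons_cons.1 h.tail).1
    rw [listValue_inr, listValue_inl] at hs
    have := mul_right_cancel_of_falls hV (x' := s * (letterOne V a * (p : WithOne (FreePro V A))))
      hpb hb (by simpa only [mul_assoc] using hs)
    exact hp s this
  | Sum.inr p :: Sum.inr q :: l, a, h => ((List.isChain_cons_cons.1 h.tail).1 : False).elim

theorem letter_mul_ne_multiregular_mul (hV : V.ClosedUnderBideterministicProduct) {a : A}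
    {y q : WithOne (FreePro V A)} {p : FreePro V A} (hy : LeftFalls a y)
    (hp : p ∈ Subsemigroup.closure {x : FreePro V A | RegularElement x}) :
    letterOne V a * y ≠ p * q := by
  intro h
  rcases exists_refinement hV (rightFalls_one a) hy ((one_mul _).trans h) with
    ⟨t, ht, rfl⟩ | ⟨t, ht, -⟩
  · exact not_falls_of_mem_closure_regular hV hp 1 t a (rightFalls_one a) hy.of_mul_right ht.symm
  · exact coe_mul_ne_one p t ht.symm

/-- If one of `p`, `p'` extended past the other by at least a letter, it would contain the break
following the shorter one. Only `p = p'` remains. -/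
theorem multiregular_mul_letter_inj (hV : V.ClosedUnderBideterministicProduct) {a b : A}
    {y y' : WithOne (FreePro V A)} {p p' : FreePro V A}
    (hp : p ∈ Subsemigroup.closure {x : FreePro V A | RegularElement x})
    (hp' : p' ∈ Subsemigroup.closure {x : FreePro V A | RegularElement x})
    (ha : RightFalls (p : WithOne (FreePro V A)) a) (hy : LeftFalls a y)
    (hb : RightFalls (p' : WithOne (FreePro V A)) b) (hy' : LeftFalls b y')
    (h : p * (letterOne V a * y) = p' * (letterOne V b * y')) : p = p' ∧ a = b ∧ y = y' := by
  rcases exists_refinement hV ha hy h with ⟨t, ht, rfl⟩ | ⟨t, ht, hq⟩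
  · exact absurd ht.symm
      (not_falls_of_mem_closure_regular hV hp' _ t a ha hy.of_mul_right)
  · have hta : RightFalls t a := RightFalls.of_mul_left (s := p') (ht ▸ ha)
    rcases exists_refinement hV hta hy hq.symm with ⟨s, hs, -⟩ | ⟨s, hs, rfl⟩
    -- Here `b = t·a·s`; a single letter has no room for both a nontrivial `t` and the letter `a`.
    · have ht1 : t = 1 := by
        rcases exists_refinement hV (rightFalls_one b) (leftFalls_one b)
          ((one_mul _).trans ((mul_one _).trans hs)) with ⟨r, -, hr⟩ | ⟨r, hr, -⟩
        · exact absurd hr (one_ne_mul_letter_mul a r s)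
        · exact eq_one_of_mul_eq_one hr.symm
      rw [ht1, mul_one] at ht
      rw [ht1, one_mul] at hq
      obtain ⟨rfl, rfl⟩ := letter_cons_inj hV hy hq.symm
      exact ⟨WithOne.coe_inj.1 ht, rfl, rfl⟩
    · rw [hs] at ht
      exact absurd ht.symm
        (not_falls_of_mem_closure_regular hV hp _ s b hb hy'.of_mul_right)

/-- A multiregularly organized list with short breaks is determined by its value. -/
theorem list_eq_of_listValue_eq (hV : V.ClosedUnderBideterministicProduct) :
    ∀ l l' : List (A ⊕ FreePro V A), l.IsChain Adjacent → l'.IsChain Adjacent →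
      (∀ p, Sum.inr p ∈ l → p ∈ Subsemigroup.closure {x : FreePro V A | RegularElement x}) →
      (∀ p, Sum.inr p ∈ l' → p ∈ Subsemigroup.closure {x : FreePro V A | RegularElement x}) →
      listValue l = listValue l' → l = l'
  | [], [], _, _, _, _, _ => rfl
  | [], x :: l', _, _, _, _, h => absurd h.symm (listValue_cons_ne_one x l')
  | x :: l, [], _, _, _, _, h => absurd h (listValue_cons_ne_one x l)
  | Sum.inl a :: l, Sum.inl b :: l', hl, hl', hm, hm', h => by
    rw [listValue_inl, listValue_inl] at h
    obtain ⟨rfl, hll⟩ := letter_cons_inj hV (leftFalls_listValue hV l a hl) h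
    rw [list_eq_of_listValue_eq hV l l' hl.tail hl'.tail
      (fun p hp => hm p (List.mem_cons_of_mem _ hp))
      (fun p hp => hm' p (List.mem_cons_of_mem _ hp)) hll]
  | Sum.inl a :: l, Sum.inr p :: l', hl, _, _, hm', h => by
    rw [listValue_inl, listValue_inr] at h
    exact absurd h (letter_mul_ne_multiregular_mul hV (leftFalls_listValue hV l a hl)
      (hm' p List.mem_cons_self))
  | Sum.inr p :: l, Sum.inl a :: l', _, hl', hm, _, h => by
    rw [listValue_inl, listValue_inr] at h
    exact absurd h.symm (letter_mul_ne_multiregular_mul hV (leftFalls_listValue hV l' a hl')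
      (hm p List.mem_cons_self))
  | [Sum.inr p], [Sum.inr q], _, _, _, _, h => by
    simp only [listValue_inr, listValue_nil, mul_one, WithOne.coe_inj] at h
    rw [h]
  | [Sum.inr p], Sum.inr q :: Sum.inl b :: l', _, hl', hm, _, h => by
    rw [listValue_inr, listValue_inr, listValue_inl, listValue_nil, mul_one] at h
    -- If the other list continues after its block, the multiregular `p` contains the break at `b`.
    exact absurd h.symm (not_falls_of_mem_closure_regular hV (hm p List.mem_cons_self) _ _ b
      (List.isChain_cons_cons.1 hl').1 (leftFalls_listValue hV l' b hl'.tail))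
  | Sum.inr p :: Sum.inl a :: l, [Sum.inr q], hl, _, _, hm', h => by
    rw [listValue_inr, listValue_inr, listValue_inl, listValue_nil, mul_one] at h
    exact absurd h (not_falls_of_mem_closure_regular hV (hm' q List.mem_cons_self) _ _ a
      (List.isChain_cons_cons.1 hl).1 (leftFalls_listValue hV l a hl.tail))
  | Sum.inr p :: Sum.inr q :: l, _, hl, _, _, _, _ =>
    ((List.isChain_cons_cons.1 hl).1 : False).elim
  | _, Sum.inr p :: Sum.inr q :: l, _, hl', _, _, _ =>
    ((List.isChain_cons_cons.1 hl').1 : False).elim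
  | Sum.inr p :: Sum.inl a :: l, Sum.inr q :: Sum.inl b :: l', hl, hl', hm, hm', h => by
    simp only [listValue_inr, listValue_inl] at h
    obtain ⟨rfl, rfl, hll⟩ := multiregular_mul_letter_inj hV (hm p List.mem_cons_self)
      (hm' q List.mem_cons_self) (List.isChain_cons_cons.1 hl).1
      (leftFalls_listValue hV l a hl.tail) (List.isChain_cons_cons.1 hl').1
      (leftFalls_listValue hV l' b hl'.tail) h
    rw [list_eq_of_listValue_eq hV l l' hl.tail.tail hl'.tail.tail
      (fun p hp => hm p (List.mem_cons_of_mem _ (List.mem_cons_of_mem _ hp)))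
      (fun p hp => hm' p (List.mem_cons_of_mem _ (List.mem_cons_of_mem _ hp))) hll]

end Pieces

/-! ### Factorizations as lists of letters and blocks -/

section Weave

variable {α β : Type*}

/-- The list `u₀ p₁ u₁ ⋯ pₙ uₙ` of letters and blocks. -/
def weave {n : ℕ} (word : Fin (n + 1) → List α) (block : Fin n → β) : List (α ⊕ β) :=
  (word 0).map Sum.inl ++
    (List.ofFn fun j : Fin n => Sum.inr (block j) :: (word j.succ).map Sum.inl).flatten

theorem weave_zero (word : Fin 1 → List α) (block : Fin 0 → β) :
    weave word block = (word 0).map Sum.inl := by simp [weave]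

theorem weave_succ {n : ℕ} (word : Fin (n + 2) → List α) (block : Fin (n + 1) → β) :
    weave word block = (word 0).map Sum.inl ++
      Sum.inr (block 0) :: weave (fun i => word i.succ) (fun j => block j.succ) := by
  simp [weave, List.ofFn_succ]

theorem map_inl_append_inr_inj {p p' : β} {r r' : List (α ⊕ β)} :
    ∀ {u u' : List α}, u.map Sum.inl ++ Sum.inr p :: r = u'.map Sum.inl ++ Sum.inr p' :: r' →
      u = u' ∧ p = p' ∧ r = r'
  | [], [], h => by simpa using h
  | [], b :: u', h => by simp at h
  | a :: u, [], h => by simp at h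
  | a :: u, b :: u', h => by
    simp only [List.map_cons, List.cons_append, List.cons.injEq, Sum.inl.injEq] at h
    obtain ⟨rfl, h'⟩ := h
    obtain ⟨rfl, hpr⟩ := map_inl_append_inr_inj h'
    exact ⟨rfl, hpr⟩

/-- The blocks are the only `Sum.inr` entries, so they mark where each word ends. -/
theorem weave_inj {n m : ℕ} {word : Fin (n + 1) → List α} {block : Fin n → β}
    {word' : Fin (m + 1) → List α} {block' : Fin m → β}
    (h : weave word block = weave word' block') :
    ∃ e : n = m, (∀ i, word i = word' (Fin.cast (congrArg (· + 1) e) i)) ∧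
      ∀ j, block j = block' (Fin.cast e j) := by
  induction n generalizing m with
  | zero =>
    cases m with
    | zero =>
      rw [weave_zero, weave_zero] at h
      refine ⟨rfl, fun i => ?_, fun j => j.elim0⟩
      obtain rfl : i = 0 := Fin.fin_one_eq_zero i
      exact List.map_injective_iff.2 Sum.inl_injective h
    | succ m =>
      rw [weave_zero, weave_succ] at h
      have : (Sum.inr (block' 0) : α ⊕ β) ∈ (word 0).map Sum.inl := by rw [h]; simp
      simp at this
  | succ n ih =>
    cases m with
    | zero =>
      rw [weave_zero, weave_succ] at h
      have : (Sum.inr (block 0) : α ⊕ β) ∈ (word' 0).map Sum.inl := by rw [← h]; simp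
      simp at this
    | succ m =>
      rw [weave_succ, weave_succ] at h
      obtain ⟨h0, hp, h⟩ := map_inl_append_inr_inj h
      obtain ⟨rfl, hw, hb⟩ := ih h
      exact ⟨rfl, Fin.cases h0 hw, Fin.cases hp hb⟩

theorem inr_mem_weave {n : ℕ} {word : Fin (n + 1) → List α} {block : Fin n → β} {p : β}
    (h : Sum.inr p ∈ weave word block) : ∃ j, p = block j := by
  simp only [weave, List.mem_append, List.mem_map, reduceCtorEq, and_false, exists_false,
    false_or, List.mem_flatten, List.mem_ofFn'] at h
  obtain ⟨_, ⟨j, rfl⟩, h⟩ := h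
  exact ⟨j, by simpa using h⟩

theorem isChain_weave {V : Pseudovariety.{u}} {A : Type u} {n : ℕ}
    {word : Fin (n + 1) → List A} {block : Fin n → FreePro V A}
    (hne : ∀ i, i ≠ 0 → i ≠ Fin.last n → word i ≠ [])
    (hr : ∀ j, ∀ b ∈ (word j.succ).head?, RightFalls (block j : WithOne (FreePro V A)) b)
    (hl : ∀ j, ∀ a ∈ (word j.castSucc).getLast?,
      LeftFalls a (block j : WithOne (FreePro V A))) :
    (weave word block).IsChain Adjacent := by
  have hword : ∀ u : List A,
      (u.map Sum.inl : List (A ⊕ FreePro V A)).IsChain Adjacent := by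
    intro u
    induction u with
    | nil => exact List.IsChain.nil
    | cons a u ih =>
      refine List.isChain_cons.2 ⟨fun y hy => ?_, ih⟩
      cases u with
      | nil => simp at hy
      | cons b u =>
        obtain rfl : Sum.inl b = y := by simpa using hy
        exact trivial
  induction n with
  | zero => rw [weave_zero]; exact hword _
  | succ n ih =>
    rw [weave_succ]
    refine List.isChain_append.2 ⟨hword _, List.isChain_cons.2 ⟨?_, ih ?_ ?_ ?_⟩, ?_⟩
    · intro y hy
      cases hw : word 1 with
      | cons b u =>
        have hy : Sum.inl b = y := by simpa [weave, hw] using hy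
        rw [← hy]
        exact hr 0 b (by simp [hw])
      | nil =>
        cases n with
        | zero => simp [weave_zero, hw] at hy
        | succ n =>
          -- With at least two blocks, `word 1` is an inner word; if it were empty, two blocks would
          -- be neighbours.
          exact absurd hw (hne _ (by simp) (by simp [Fin.ext_iff]))
    · intro i _ hi
      exact hne i.succ (Fin.succ_ne_zero _) (by rwa [Ne, ← Fin.succ_last, Fin.succ_inj])
    · exact fun j => hr j.succ
    · exact fun j => hl j.succ
    · intro x hx y hy
      obtain rfl : Sum.inr (block 0) = y := by simpa using hy
      rw [List.getLast?_map] at hx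
      obtain ⟨a, ha, rfl⟩ := Option.map_eq_some_iff.1 hx
      exact hl 0 a ha

end Weave

/-! ### From factorizations of pseudowords to lists in the free pro-`V` semigroup -/

section Main

variable {V : Pseudovariety.{u}} {A : Type u}

/-- Each coordinate of the projection is itself an evaluation in a member of `V`, and conversely
every evaluation in a member of `V` factors through the projection. -/
theorem models_iff {π ρ : FreeProfinite A} :
    V.Models π ρ ↔ projection V π = projection V ρ := by
  constructor
  · intro h
    refine FreePro.ext fun c => ?_
    let φ : A → c.Carrier := fun a => coord c (letter V a)
    let f : FreeProfinite A →ₙ* c.Carrier := coord (Index.toAll V c)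
    have hc : V.Mem c.Carrier := c.2
    have hf : f = extend (V := allFinite) (V.finite_of_mem _ hc) φ :=
      (extend_unique (V := allFinite) (V.finite_of_mem _ hc) φ f).1
        ⟨continuous_coord (Index.toAll V c), fun a => rfl⟩
    have hφ := h c.Carrier hc φ
    rw [← hf] at hφ
    exact hφ
  · intro h S _ hS φ
    exact congrArg (extend hS φ) h

theorem rightFalls_of_rLt {p : FreePro V A} {b : A} (h : RLt (p * letter V b) p) :
    RightFalls (p : WithOne (FreePro V A)) b := by
  intro t ht
  refine h.2 ?_
  induction t using WithOne.recOneCoe with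
  | one =>
    rw [mul_one] at ht
    exact Or.inl (WithOne.coe_inj.1 ht)
  | coe t => exact Or.inr ⟨t, (WithOne.coe_inj.1 ht).trans (mul_assoc _ _ _).symm⟩

theorem leftFalls_of_lLt {p : FreePro V A} {a : A} (h : LLt (letter V a * p) p) :
    LeftFalls a (p : WithOne (FreePro V A)) := by
  intro t ht
  refine h.2 ?_
  induction t using WithOne.recOneCoe with
  | one =>
    rw [one_mul] at ht
    exact Or.inl (WithOne.coe_inj.1 ht)
  | coe t => exact Or.inr ⟨t, WithOne.coe_inj.1 ht⟩

variable {n : ℕ} {π : FreeProfinite A}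

/-- The list of the letters and of the projected blocks of a factorization. -/
def Factorization.pieces (F : Factorization n π) (V : Pseudovariety.{u}) :
    List (A ⊕ FreePro V A) :=
  weave F.word fun j => projection V (F.block j)

theorem listValue_map_inl (w : List A) :
    listValue (w.map Sum.inl : List (A ⊕ FreePro V A)) =
      WithOne.mapMulHom (projection V) (wordValue w) := by
  induction w with
  | nil => simp [wordValue]
  | cons a w ih =>
    rw [List.map_cons, listValue_inl, ih]
    simp only [wordValue, List.map_cons, List.prod_cons, map_mul]
    rfl

theorem listValue_flatten (l : List (List (A ⊕ FreePro V A))) :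
    listValue l.flatten = (l.map listValue).prod := by
  induction l with
  | nil => rfl
  | cons x l ih => rw [List.flatten_cons, listValue_append, ih, List.map_cons, List.prod_cons]

theorem Factorization.listValue_pieces (F : Factorization n π) :
    listValue (F.pieces V) = (projection V π : FreePro V A) := by
  have h := congrArg (WithOne.mapMulHom (projection V)) F.prod_eq
  rw [WithOne.mapMulHom_coe] at h
  rw [← h, map_mul, map_list_prod, List.map_ofFn, pieces, weave, listValue_append,
    listValue_map_inl, listValue_flatten, List.map_ofFn]
  congr 3
  funext j
  simp [listValue_map_inl]

theorem Factorization.ShortBreaks.isChain_pieces {F : Factorization n π} (h : F.ShortBreaks V) :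
    (F.pieces V).IsChain Adjacent :=
  isChain_weave F.word_ne_nil
    (fun j b hb => rightFalls_of_rLt (by have := (h j).1 b hb; rwa [map_mul] at this))
    (fun j a ha => leftFalls_of_lLt (by have := (h j).2 a ha; rwa [map_mul] at this))

theorem Factorization.MultiregularlyOrganized.mem_closure {F : Factorization n π}
    (h : F.MultiregularlyOrganized V) (p : FreePro V A) (hp : Sum.inr p ∈ F.pieces V) :
    p ∈ Subsemigroup.closure {x : FreePro V A | RegularElement x} := by
  obtain ⟨j, rfl⟩ := inr_mem_weave hp
  exact h j

end Main

end Profinite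

open Profinite in
theorem theorem6p2 (V : Pseudovariety.{u}) (hV : V.ClosedUnderBideterministicProduct)
    (A : Type u) [Finite A] (π ρ : FreeProfinite A) (hπρ : V.Models π ρ)
    (n m : ℕ) (F : Factorization n π) (G : Factorization m ρ)
    (hFm : F.MultiregularlyOrganized V) (hFs : F.ShortBreaks V)
    (hGm : G.MultiregularlyOrganized V) (hGs : G.ShortBreaks V) :
    ∃ h : n = m,
      (∀ i : Fin (n + 1), F.word i = G.word (Fin.cast (congrArg (· + 1) h) i)) ∧
      (∀ j : Fin n, V.Models (F.block j) (G.block (Fin.cast h j))) := by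
  have hvalue : listValue (F.pieces V) = listValue (G.pieces V) := by
    rw [F.listValue_pieces, G.listValue_pieces, models_iff.1 hπρ]
  obtain ⟨h, hw, hb⟩ := weave_inj (list_eq_of_listValue_eq hV _ _ hFs.isChain_pieces
    hGs.isChain_pieces hFm.mem_closure hGm.mem_closure hvalue)
  exact ⟨h, hw, fun j => models_iff.2 (hb j)⟩
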